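/- Let $n$ be an integer with $n>1$ and let $\kappa$ be an infinite cardinal. Then there is an $n$-resolvable Tychonoff space $(X,\mathcal T)$ with $|X|=\kappa$ which admits no exactly $n$-resolvable quasi-regular expansion. Moreover, $(X,\mathcal T)$ can be chosen to be a subspace of the Cantor cube $\{0,1\}^{2^\kappa}$ (with the product topology) of the form $X=\bigcup_{i<n+1}D_i$, where the sets $D_i$ are pairwise disjoint, each $D_i$ is dense in $\{0,1\}^{2^\kappa}$, and each $D_i$ is submaximal in the subspace topology. Here a space is *$n$-resolvable* if it has $n$ pairwise disjoint nonempty dense subsets, and *exactly $n$-resolvable* if it is $n$-resolvable but not $(n+1)$-resolvable. It is *quasi-regular* if every nonempty open set $U$ contains the closure of some nonempty open set $V$, and *submaximal* if each of its dense subsets is open. An *expansion* of $(X,\mathcal T)$ is a space $(X,\mathcal U)$ with $\mathcal U\supseteq\mathcal T$. -/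

import Mathlib

open scoped Topology

universe u

namespace Resolvability

/-- `(X, T)` is `n`-resolvable: there are `n` pairwise disjoint nonempty subsets of `X`,
each dense in `(X, T)`. -/
def IsResolvable {X : Type*} (n : ℕ) (T : TopologicalSpace X) : Prop :=
  ∃ D : Fin n → Set X,
    (∀ i j, i ≠ j → Disjoint (D i) (D j)) ∧ ∀ i, (D i).Nonempty ∧ @Dense X T (D i)

/-- `(X, T)` is exactly `n`-resolvable: it is `n`-resolvable but not `(n + 1)`-resolvable. -/
def IsExactlyResolvable {X : Type*} (n : ℕ) (T : TopologicalSpace X) : Prop :=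
  IsResolvable n T ∧ ¬ IsResolvable (n + 1) T

/-- `(X, T)` is quasi-regular: every nonempty open set contains the closure of a nonempty
open set. -/
def IsQuasiRegular {X : Type*} (T : TopologicalSpace X) : Prop :=
  ∀ U : Set X, IsOpen[T] U → U.Nonempty →
    ∃ V : Set X, IsOpen[T] V ∧ V.Nonempty ∧ closure[T] V ⊆ U

/-- `(X, T)` is submaximal: every dense subset is open. -/
def IsSubmaximal {X : Type*} (T : TopologicalSpace X) : Prop :=
  ∀ S : Set X, @Dense X T S → IsOpen[T] S

/-- `U` is an expansion of `T`: every `T`-open set is `U`-open, that is, `U ⊇ T`. -/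
def IsExpansion {X : Type*} (U T : TopologicalSpace X) : Prop :=
  ∀ S : Set X, IsOpen[T] S → IsOpen[U] S

/-- The Cantor cube `{0,1}^(2^κ)`, with the product topology. -/
abbrev CantorCube (κ : Cardinal.{u}) : Type u := Quotient.out (2 ^ κ : Cardinal.{u}) → Bool

end Resolvability

/-! Take `X` to be the union of `n + 1` disjoint dense submaximal sets `D i`. In every
`n`-resolvable quasi-regular expansion `U`, all `D i` remain dense
(`dense_of_isQuasiRegular_expansion`), so `U` is `(n + 1)`-resolvable.

Suppose `D j` misses a nonempty `U`-open `V`. Shrink `V` so that each piece either misses it or is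
`U`-dense in it, and let `I` index the latter pieces. Disjoint subsets of one piece are never both
dense in a nonempty `U`-open set, so a cover of such a set by pieces needs at least `n` of them
(`le_card_of_subset_iUnion`); hence `|I| ≥ n`. Choose `W` with `U`-closure inside `V`. By
`exists_isOpen_inter_subset` some `T`-open `O` meeting `W` has `D i ∩ O ⊆ W` for all `i ∈ I`. Then
`O` minus the closure of `W` meets `D j`, yet at most one piece covers it, contradicting `n > 1`.

The pieces are translates of one submaximal set, built from an independent family by recoding
coordinates so that the complements of members of a minimal filter become closed. -/

namespace Resolvability

open Set Filter

/-! ### Hereditary form of submaximality -/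

/-- Within `S`, a set that is dense in some `B ⊆ S` is relatively open in `B`. -/
def RelSubmaximal {X : Type*} [TopologicalSpace X] (S : Set X) : Prop :=
  ∀ B ⊆ S, ∀ A ⊆ B, B ⊆ closure A → ∃ O, IsOpen O ∧ A = B ∩ O

/-- Adding `S \ B` to `A` gives a dense subset of `S` whose trace on `B` is `A`. Arbitrary `B`
matters because `B` is later cut out by sets open only in the expansion. -/
theorem relSubmaximal_of_isSubmaximal {X : Type*} [TopologicalSpace X] {S : Set X}
    (h : IsSubmaximal (instTopologicalSpaceSubtype : TopologicalSpace S)) : RelSubmaximal S := by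
  intro B hB A hA hBA
  have hd : Dense {x : S | (x : X) ∈ B → (x : X) ∈ A} := by
    intro x
    by_cases hx : (x : X) ∈ B
    · rw [closure_subtype]
      refine closure_mono ?_ (hBA hx)
      intro a ha
      exact ⟨⟨a, hB (hA ha)⟩, fun _ => ha, rfl⟩
    · exact subset_closure fun h => absurd h hx
  obtain ⟨O, hO, hOe⟩ := isOpen_induced_iff.1 (h _ hd)
  refine ⟨O, hO, Set.ext fun x => ⟨fun hx => ⟨hA hx, ?_⟩, fun hx => ?_⟩⟩
  · have : (⟨x, hB (hA hx)⟩ : S) ∈ Subtype.val ⁻¹' O := by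
      rw [hOe]; exact fun _ => hx
    exact this
  · have : (⟨x, hB hx.1⟩ : S) ∈ Subtype.val ⁻¹' O := hx.2
    rw [hOe] at this
    exact this hx.1

theorem RelSubmaximal.isSubmaximal {X : Type*} [TopologicalSpace X] {S : Set X}
    (h : RelSubmaximal S) :
    IsSubmaximal (instTopologicalSpaceSubtype : TopologicalSpace S) := by
  intro A hA
  obtain ⟨O, hO, hOe⟩ := h S subset_rfl (Subtype.val '' A) (by rintro _ ⟨x, -, rfl⟩; exact x.2)
    (fun x hx => by
      have := hA ⟨x, hx⟩
      rwa [closure_subtype] at this)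
  refine isOpen_induced_iff.2 ⟨O, hO, ?_⟩
  ext x
  have hx : (x : X) ∈ Subtype.val '' A ↔ (x : X) ∈ S ∩ O := by rw [hOe]
  simpa using hx.symm

theorem RelSubmaximal.preimage_val {X : Type*} [TopologicalSpace X] {S : Set X}
    (h : RelSubmaximal S) (Y : Set X) : RelSubmaximal (Subtype.val ⁻¹' S : Set Y) := by
  intro B hB A hA hBA
  obtain ⟨O, hO, hOe⟩ := h (Subtype.val '' B) (by rintro _ ⟨x, hx, rfl⟩; exact hB hx)
    (Subtype.val '' A) (image_mono hA) (by
      rintro _ ⟨x, hx, rfl⟩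
      exact closure_subtype.1 (hBA hx))
  refine ⟨Subtype.val ⁻¹' O, hO.preimage continuous_subtype_val, ?_⟩
  ext x
  have hx : (x : X) ∈ Subtype.val '' A ↔ (x : X) ∈ Subtype.val '' B ∩ O := by rw [hOe]
  simpa using hx

theorem RelSubmaximal.image_homeomorph {X Y : Type*} [TopologicalSpace X] [TopologicalSpace Y]
    {S : Set X} (h : RelSubmaximal S) (e : X ≃ₜ Y) : RelSubmaximal (e '' S) := by
  intro B hB A hA hBA
  obtain ⟨O, hO, hOe⟩ := h (e ⁻¹' B)
    (fun x hx => by obtain ⟨s, hs, hse⟩ := hB hx; rwa [← e.injective hse])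
    (e ⁻¹' A) (preimage_mono hA) (by
      rw [← e.preimage_closure]; exact preimage_mono hBA)
  refine ⟨e.symm ⁻¹' O, hO.preimage e.symm.continuous, ?_⟩
  ext y
  have hy : e.symm y ∈ e ⁻¹' A ↔ e.symm y ∈ e ⁻¹' B ∩ O := by rw [hOe]
  simpa using hy

/-! ### Expansions of a union of disjoint dense submaximal subspaces -/

/-- Finitely many properties of open sets that pass to smaller open sets, each attainable by
shrinking, are attainable simultaneously. -/
theorem exists_shrink_forall {X ι : Type*} [TopologicalSpace X] (P : ι → Set X → Prop)
    (hmono : ∀ i V V', V' ⊆ V → P i V → P i V')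
    (hex : ∀ i V, IsOpen V → V.Nonempty → ∃ V' ⊆ V, IsOpen V' ∧ V'.Nonempty ∧ P i V')
    (s : Finset ι) (V : Set X) (hV : IsOpen V) (hne : V.Nonempty) :
    ∃ V' ⊆ V, IsOpen V' ∧ V'.Nonempty ∧ ∀ i ∈ s, P i V' := by
  classical
  induction s using Finset.induction_on with
  | empty => exact ⟨V, subset_rfl, hV, hne, by simp⟩
  | insert a s _ ih =>
    obtain ⟨V₁, h₁, ho₁, hn₁, hp₁⟩ := ih
    obtain ⟨V₂, h₂, ho₂, hn₂, hp₂⟩ := hex a V₁ ho₁ hn₁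
    refine ⟨V₂, h₂.trans h₁, ho₂, hn₂, fun i hi => ?_⟩
    rcases Finset.mem_insert.1 hi with rfl | hi
    · exact hp₂
    · exact hmono i _ _ h₂ (hp₁ i hi)

theorem subset_closure_of_forall_inter {X : Type*} [TopologicalSpace X] {V A : Set X}
    (hV : IsOpen V)
    (h : ∀ V' ⊆ V, IsOpen V' → V'.Nonempty → (V' ∩ A).Nonempty) : V ⊆ closure A := by
  intro x hx
  rw [mem_closure_iff]
  intro o ho hxo
  obtain ⟨y, hy, hyA⟩ := h (o ∩ V) inter_subset_right (ho.inter hV) ⟨x, hxo, hx⟩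
  exact ⟨y, hy.1, hyA⟩

section Expansion

variable {X : Type*} {T U : TopologicalSpace X}

theorem closure_subset_of_isExpansion (hUT : IsExpansion U T) (A : Set X) :
    closure[U] A ⊆ closure[T] A := by
  have hc : IsClosed[U] (closure[T] A) :=
    ⟨hUT _ (@isClosed_closure X T A).isOpen_compl⟩
  exact @closure_minimal X U A _ (@subset_closure X T A) hc

/-- A submaximal subspace stays hereditarily irresolvable in every expansion. -/
theorem exists_shrink_disjoint (hUT : IsExpansion U T) {S : Set X}
    (hS : @RelSubmaximal X T S) {A B : Set X} (hA : A ⊆ S) (hB : B ⊆ S) (hAB : Disjoint A B)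
    (V : Set X) (hV : IsOpen[U] V) (hne : V.Nonempty) :
    ∃ V' ⊆ V, IsOpen[U] V' ∧ V'.Nonempty ∧ (Disjoint V' A ∨ Disjoint V' B) := by
  by_contra! hcon
  have key : ∀ V' ⊆ V, IsOpen[U] V' → V'.Nonempty → (V' ∩ A).Nonempty ∧ (V' ∩ B).Nonempty := by
    intro V' h1 h2 h3
    have := hcon V' h1 h2 h3
    exact ⟨not_disjoint_iff_nonempty_inter.1 this.1, not_disjoint_iff_nonempty_inter.1 this.2⟩
  have hdA : V ⊆ closure[U] (V ∩ A) := by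
    refine @subset_closure_of_forall_inter X U V _ hV fun V' h1 h2 h3 => ?_
    obtain ⟨y, hy, hyA⟩ := (key V' h1 h2 h3).1
    exact ⟨y, hy, h1 hy, hyA⟩
  -- `V ∩ A` is dense in `V ∩ (A ∪ B)`, hence the trace of a `T`-open `O`; but `V ∩ O` must also
  -- meet `B`.
  obtain ⟨O, hO, hOe⟩ := hS (V ∩ (A ∪ B)) (fun x hx => hx.2.elim (hA ·) (hB ·)) (V ∩ A)
    (inter_subset_inter_right _ subset_union_left)
    (fun x hx => closure_subset_of_isExpansion hUT _ (hdA hx.1))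
  obtain ⟨a, haV, haA⟩ := (key V subset_rfl hV hne).1
  have haO : a ∈ V ∩ (A ∪ B) ∩ O := hOe ▸ ⟨haV, haA⟩
  obtain ⟨b, ⟨hbV, hbO⟩, hbB⟩ := (key (V ∩ O) inter_subset_left
    (@IsOpen.inter X U _ _ hV (hUT _ hO)) ⟨a, haV, haO.2⟩).2
  have hb : b ∈ V ∩ A := by rw [hOe]; exact ⟨⟨hbV, Or.inr hbB⟩, hbO⟩
  exact disjoint_left.1 hAB hb.2 hbB

/-- In an expansion with `n` disjoint dense sets, a nonempty open set cannot be covered by fewer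
than `n` of the submaximal pieces. -/
theorem le_card_of_subset_iUnion (hUT : IsExpansion U T) {ι : Type*} {D : ι → Set X}
    (hD : ∀ i, @RelSubmaximal X T (D i)) {n : ℕ} {E : Fin n → Set X}
    (hE : ∀ i j, i ≠ j → Disjoint (E i) (E j)) (hEd : ∀ i, @Dense X U (E i))
    (I : Finset ι) (V : Set X) (hV : IsOpen[U] V) (hne : V.Nonempty)
    (hVI : V ⊆ ⋃ i ∈ I, D i) : n ≤ I.card := by
  classical
  -- After shrinking, each piece meets at most one `E j` inside `V'`, so choosing a piece for each
  -- `j` is injective.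
  obtain ⟨V', hV', ho, hn', hP⟩ := @exists_shrink_forall X (ι × Fin n × Fin n) U
    (fun p W => p.2.1 ≠ p.2.2 → Disjoint W (E p.2.1 ∩ D p.1) ∨ Disjoint W (E p.2.2 ∩ D p.1))
    (fun i W W' hW h hij => (h hij).imp (·.mono_left hW) (·.mono_left hW))
    (fun p W hW hWn => by
      by_cases hp : p.2.1 = p.2.2
      · exact ⟨W, subset_rfl, hW, hWn, fun h => absurd hp h⟩
      · obtain ⟨W', h1, h2, h3, h4⟩ := exists_shrink_disjoint hUT (hD p.1)
          (A := E p.2.1 ∩ D p.1) (B := E p.2.2 ∩ D p.1) inter_subset_right inter_subset_right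
          ((hE _ _ hp).mono inter_subset_left inter_subset_left) W hW hWn
        exact ⟨W', h1, h2, h3, fun _ => h4⟩)
    (I ×ˢ Finset.univ) V hV hne
  have hpt : ∀ j, ∃ i ∈ I, (V' ∩ (E j ∩ D i)).Nonempty := by
    intro j
    obtain ⟨x, hxV, hxE⟩ := @Dense.inter_open_nonempty X U _ (hEd j) V' ho hn'
    obtain ⟨i, hi, hxD⟩ := mem_iUnion₂.1 (hVI (hV' hxV))
    exact ⟨i, hi, x, hxV, hxE, hxD⟩
  choose f hfI hf using hpt
  have hinj : Function.Injective f := by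
    intro j k hjk
    by_contra hne'
    rcases hP (f j, j, k) (by simp [hfI]) hne' with h | h
    · exact not_disjoint_iff_nonempty_inter.2 (hf j) h
    · have hk := hf k
      rw [← hjk] at hk
      exact not_disjoint_iff_nonempty_inter.2 hk h
  have := Finset.card_le_card_of_injOn (s := Finset.univ) (t := I) f (fun j _ => hfI j)
    hinj.injOn
  simpa using this

/-- If a dense submaximal piece `S` is dense in a nonempty open set `W` of a crowded expansion,
then `W` contains a nonempty relatively open part of `S`. -/
theorem exists_isOpen_inter_subset (hUT : IsExpansion U T) (hT : @T1Space X T)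
    (hU : ∀ x, ¬ IsOpen[U] {x}) {S : Set X} (hS : @RelSubmaximal X T S) (hSd : @Dense X T S)
    {W O : Set X} (hW : IsOpen[U] W) (hWS : W ⊆ closure[U] S) (hO : IsOpen[T] O)
    (hne : (O ∩ W).Nonempty) :
    ∃ O' ⊆ O, IsOpen[T] O' ∧ (O' ∩ W).Nonempty ∧ S ∩ O' ⊆ W := by
  have hOW : IsOpen[U] (O ∩ W) := @IsOpen.inter X U _ _ (hUT _ hO) hW
  have hmeet : ∀ N, IsOpen[U] N → (N ∩ (O ∩ W)).Nonempty → (N ∩ (S ∩ (O ∩ W))).Nonempty := by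
    rintro N hN ⟨x, hxN, hx⟩
    obtain ⟨y, hy, hyS⟩ := (@mem_closure_iff X U x S).1 (hWS hx.2) (N ∩ (O ∩ W))
      (@IsOpen.inter X U _ _ hN hOW) ⟨hxN, hx⟩
    exact ⟨y, hy.1, hyS, hy.2⟩
  set A := S ∩ (O ∩ W) with hA
  obtain ⟨a, -, ha⟩ := hmeet univ (@isOpen_univ X U) (by simpa using hne)
  let := T
  by_cases hG : (interior (closure A)).Nonempty
  · obtain ⟨y, hyG, hyA⟩ : (interior (closure A) ∩ A).Nonempty := by
      obtain ⟨x, hx⟩ := hG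
      exact mem_closure_iff.1 (interior_subset hx) _ isOpen_interior hx
    obtain ⟨O₁, hO₁, hO₁e⟩ := hS (interior (closure A) ∩ S) inter_subset_right
      (interior (closure A) ∩ A) (inter_subset_inter_right _ inter_subset_left) (by
        rintro x ⟨hx, -⟩
        rw [mem_closure_iff]
        intro o ho hxo
        obtain ⟨z, hz, hzA⟩ := mem_closure_iff.1 (interior_subset hx) (o ∩ interior (closure A))
          (ho.inter isOpen_interior) ⟨hxo, hx⟩
        exact ⟨z, hz.1, hz.2, hzA⟩)
    have hy : y ∈ interior (closure A) ∩ S ∩ O₁ := hO₁e ▸ ⟨hyG, hyA⟩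
    refine ⟨interior (closure A) ∩ O₁ ∩ O, inter_subset_right,
      (isOpen_interior.inter hO₁).inter hO, ⟨y, ⟨⟨hyG, hy.2⟩, hyA.2.1⟩, hyA.2.2⟩, ?_⟩
    rintro z ⟨hzS, ⟨hzG, hzO₁⟩, hzO⟩
    have hz : z ∈ interior (closure A) ∩ A := by rw [hO₁e]; exact ⟨⟨hzG, hzS⟩, hzO₁⟩
    exact hz.2.2.2
  -- Now `A` is nowhere dense, so `S \ (A \ {a})` is dense in `S`, hence relatively open. This
  -- isolates `a` in `A`, and therefore in `U`, as `A` is `U`-dense in `O ∩ W` and points are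
  -- closed.
  · exfalso
    obtain ⟨N, hN, hNe⟩ := hS S subset_rfl (S \ (A \ {a})) sdiff_subset (by
      intro x _
      rw [mem_closure_iff]
      intro o ho hxo
      have : (o \ closure A).Nonempty := by
        by_contra hcon
        rw [not_nonempty_iff_eq_empty, sdiff_eq_empty] at hcon
        exact hG ⟨x, mem_interior.2 ⟨o, hcon, ho, hxo⟩⟩
      obtain ⟨z, hz, hzS⟩ := hSd.inter_open_nonempty _ (ho.sdiff isClosed_closure) this
      exact ⟨z, hz.1, hzS, fun hzA => hz.2 (subset_closure hzA.1)⟩)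
    have haN : a ∈ S ∩ N := hNe ▸ ⟨ha.1, fun h => h.2 rfl⟩
    refine hU a ?_
    have hNW : IsOpen[U] (N ∩ (O ∩ W)) := @IsOpen.inter X U _ _ (hUT _ hN) hOW
    have hsub : N ∩ (O ∩ W) = {a} := by
      refine Subset.antisymm (fun x hx => ?_) (by rintro _ rfl; exact ⟨haN.2, ha.2⟩)
      by_contra hxa
      obtain ⟨z, ⟨hzN, hza⟩, hzA⟩ := hmeet (N ∩ {a}ᶜ)
        (@IsOpen.inter X U _ _ (hUT _ hN) (hUT _ isOpen_compl_singleton)) ⟨x, ⟨hx.1, hxa⟩, hx.2⟩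
      have hz : z ∈ S \ (A \ {a}) := by rw [hNe]; exact ⟨hzA.1, hzN⟩
      exact hz.2 ⟨hzA, hza⟩
    rwa [hsub] at hNW

/-- Every dense submaximal piece stays dense in an `n`-resolvable quasi-regular expansion. -/
theorem dense_of_isQuasiRegular_expansion {n : ℕ} (hn : 1 < n) (hT : @T1Space X T)
    {D : Fin (n + 1) → Set X} (hcov : ⋃ i, D i = univ) (hD : ∀ i, @RelSubmaximal X T (D i))
    (hDd : ∀ i, @Dense X T (D i)) (hUT : IsExpansion U T) (hres : IsResolvable n U)
    (hqr : IsQuasiRegular U) (j : Fin (n + 1)) : @Dense X U (D j) := by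
  classical
  obtain ⟨E, hE, hEd⟩ := hres
  have hcrowd : ∀ x, ¬ IsOpen[U] {x} := by
    intro x hx
    have hmem : ∀ i, x ∈ E i := by
      intro i
      obtain ⟨y, rfl, hy⟩ := @Dense.inter_open_nonempty X U _ (hEd i).2 {x} hx ⟨x, rfl⟩
      exact hy
    exact disjoint_left.1 (hE ⟨0, by omega⟩ ⟨1, hn⟩ (by simp)) (hmem _) (hmem _)
  by_contra hj
  obtain ⟨V₀, hV₀, hV₀n, hV₀j⟩ : ∃ V, IsOpen[U] V ∧ V.Nonempty ∧ Disjoint V (D j) := by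
    by_contra! hcon
    refine hj ((@dense_iff_inter_open X U _).2 fun V hV hVn => ?_)
    exact not_disjoint_iff_nonempty_inter.1 (hcon V hV hVn)
  obtain ⟨V, hVV₀, hV, hVn, hVP⟩ := @exists_shrink_forall X (Fin (n + 1)) U
    (fun i W => Disjoint W (D i) ∨ W ⊆ closure[U] (D i))
    (fun i W W' hW h => h.imp (·.mono_left hW) (hW.trans ·))
    (fun i W hW hWn => by
      by_cases h : ∃ W' ⊆ W, IsOpen[U] W' ∧ W'.Nonempty ∧ Disjoint W' (D i)
      · obtain ⟨W', h1, h2, h3, h4⟩ := h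
        exact ⟨W', h1, h2, h3, Or.inl h4⟩
      · push Not at h
        refine ⟨W, subset_rfl, hW, hWn, Or.inr ?_⟩
        exact @subset_closure_of_forall_inter X U W _ hW fun V' h1 h2 h3 =>
          not_disjoint_iff_nonempty_inter.1 (h V' h1 h2 h3))
    Finset.univ V₀ hV₀ hV₀n
  set I : Finset (Fin (n + 1)) := Finset.univ.filter fun i => ¬ Disjoint V (D i) with hI
  have hcovI : V ⊆ ⋃ i ∈ I, D i := by
    intro x hx
    obtain ⟨i, hi⟩ := mem_iUnion.1 (hcov.symm ▸ mem_univ x : x ∈ ⋃ i, D i)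
    exact mem_iUnion₂.2 ⟨i, by simpa [hI] using not_disjoint_iff.2 ⟨x, hx, hi⟩, hi⟩
  have hcard := le_card_of_subset_iUnion hUT hD hE (fun i => (hEd i).2) I V hV hVn hcovI
  obtain ⟨W, hW, hWn, hWV⟩ := hqr V hV hVn
  have hWV' : W ⊆ V := (@subset_closure X U W).trans hWV
  obtain ⟨O, hO, hOn, hOI⟩ : ∃ O, IsOpen[T] O ∧ (O ∩ W).Nonempty ∧ ∀ i ∈ I, D i ∩ O ⊆ W := by
    have hIcl : ∀ i ∈ I, W ⊆ closure[U] (D i) := fun i hi =>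
      hWV'.trans ((hVP i (Finset.mem_univ i)).resolve_left (Finset.mem_filter.1 hi).2)
    clear_value I
    clear hI hcovI hcard
    induction I using Finset.induction_on with
    | empty => exact ⟨univ, @isOpen_univ X T, by simpa using hWn, by simp⟩
    | insert k s _ ih =>
      obtain ⟨O, hO, hOn, hOs⟩ := ih fun i hi => hIcl i (Finset.mem_insert_of_mem hi)
      obtain ⟨O', hO'O, hO', hO'n, hO'k⟩ := exists_isOpen_inter_subset hUT hT hcrowd (hD k) (hDd k)
        hW (hIcl k (Finset.mem_insert_self k s)) hO hOn
      refine ⟨O', hO', hO'n, fun i hi => ?_⟩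
      rcases Finset.mem_insert.1 hi with rfl | hi
      · exact hO'k
      · exact (inter_subset_inter_right _ hO'O).trans (hOs i hi)
  have hHo : IsOpen[U] (O ∩ (closure[U] W)ᶜ) := @IsOpen.inter X U _ _ (hUT _ hO)
    (@IsClosed.isOpen_compl X U _ (@isClosed_closure X U W))
  have hHn : (O ∩ (closure[U] W)ᶜ).Nonempty := by
    obtain ⟨x, hxO, hxj⟩ := @Dense.inter_open_nonempty X T _ (hDd j) O hO hOn.left
    exact ⟨x, hxO, fun hx => disjoint_left.1 hV₀j (hVV₀ (hWV hx)) hxj⟩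
  have hcovH : O ∩ (closure[U] W)ᶜ ⊆ ⋃ i ∈ Iᶜ, D i := by
    rintro x ⟨hxO, hxW⟩
    obtain ⟨i, hi⟩ := mem_iUnion.1 (hcov.symm ▸ mem_univ x : x ∈ ⋃ i, D i)
    refine mem_iUnion₂.2 ⟨i, Finset.mem_compl.2 fun hiI => hxW ?_, hi⟩
    exact @subset_closure X U W _ (hOI i hiI ⟨hi, hxO⟩)
  have hcard' := le_card_of_subset_iUnion hUT hD hE (fun i => (hEd i).2) Iᶜ _ hHo hHn hcovH
  rw [Finset.card_compl, Fintype.card_fin] at hcard'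
  omega

end Expansion

/-! ### A dense submaximal subspace of a Cantor cube -/

/-- The points whose code agrees with `x` on the finite set `s` of coordinates. -/
def cylinder {Y Ξ : Type*} (φ : Y → Ξ → Bool) (s : Finset Ξ) (x : Ξ → Bool) : Set Y :=
  {y | ∀ ξ ∈ s, φ y ξ = x ξ}

theorem exists_finset_cylinder_subset {Ξ : Type*} {O : Set (Ξ → Bool)} (hO : IsOpen O)
    {x : Ξ → Bool} (hx : x ∈ O) : ∃ s : Finset Ξ, cylinder id s x ⊆ O := by
  obtain ⟨s, u, hu, hsub⟩ := isOpen_pi_iff.1 hO x hx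
  refine ⟨s, fun y hy => hsub fun ξ hξ => ?_⟩
  have : y ξ = x ξ := hy ξ hξ
  rw [this]
  exact (hu ξ hξ).2

theorem isOpen_cylinder {Ξ : Type*} (s : Finset Ξ) (x : Ξ → Bool) :
    IsOpen (cylinder id s x) := by
  have : cylinder id s x = (s : Set Ξ).pi fun ξ => {x ξ} := by
    ext y; simp [cylinder, Set.mem_pi]
  rw [this]
  exact isOpen_set_pi s.finite_toSet fun _ _ => isOpen_discrete _

/-- There is a filter finer than the cofinite one, all of whose members meet all cylinders, and
minimal with this property. -/
theorem exists_filter_minimal {Y Ξ : Type*} {φ : Y → Ξ → Bool}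
    (hφ : ∀ s x, (cylinder φ s x).Infinite) :
    ∃ F : Filter Y, F ≤ cofinite ∧ (∀ s x, (cylinder φ s x)ᶜ ∉ F) ∧
      ∀ A, A ∉ F → ∃ s x, ∃ I ∈ F, cylinder φ s x ∩ I ⊆ Aᶜ := by
  let P : Set (Filter Y)ᵒᵈ :=
    {F | OrderDual.ofDual F ≤ cofinite ∧ ∀ s x, (cylinder φ s x)ᶜ ∉ OrderDual.ofDual F}
  have hcof : OrderDual.toDual (cofinite : Filter Y) ∈ P := by
    refine ⟨le_rfl, fun s x h => hφ s x ?_⟩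
    simpa using mem_cofinite.1 h
  obtain ⟨F, -, hF⟩ := zorn_le_nonempty₀ P (by
    intro c hc hchain F₀ hF₀
    have hdir : DirectedOn (· ≥ ·) (OrderDual.toDual ⁻¹' c : Set (Filter Y)) := by
      intro f hf g hg
      rcases hchain.total hf hg with h | h
      · exact ⟨g, hg, h, le_rfl⟩
      · exact ⟨f, hf, le_rfl, h⟩
    refine ⟨OrderDual.toDual (sInf (OrderDual.toDual ⁻¹' c : Set (Filter Y))), ⟨?_, ?_⟩, ?_⟩
    · exact (sInf_le (a := OrderDual.ofDual F₀) hF₀).trans (hc hF₀).1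
    · intro s x h
      rw [OrderDual.ofDual_toDual, sInf_eq_iInf] at h
      obtain ⟨f, hf, hfm⟩ := (mem_biInf_of_directed (f := fun g : Filter Y => g) hdir
        ⟨OrderDual.ofDual F₀, hF₀⟩).1 h
      exact (hc hf).2 s x hfm
    · intro f hf
      exact sInf_le (a := OrderDual.ofDual f) hf) _ hcof
  refine ⟨OrderDual.ofDual F, hF.prop.1, hF.prop.2, fun A hA => ?_⟩
  by_contra! hcon
  -- If `A` meets every `cylinder ∩ I`, adjoining `A` to `F` keeps it admissible; minimality then
  -- puts `A` in `F`.
  have hmem : OrderDual.toDual (OrderDual.ofDual F ⊓ 𝓟 A) ∈ P := by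
    refine ⟨inf_le_left.trans hF.prop.1, fun s x h => ?_⟩
    exact hcon s x _ (mem_inf_principal.1 h) fun y hy hyA => hy.2 hyA hy.1
  have hle : OrderDual.ofDual F ≤ OrderDual.ofDual F ⊓ 𝓟 A := hF.le_of_ge hmem
    (inf_le_left : OrderDual.ofDual F ⊓ 𝓟 A ≤ OrderDual.ofDual F)
  exact hA (le_principal_iff.1 (hle.trans inf_le_right))

/-- A coding with infinite cylinders and sufficiently many coordinates can be altered so that it
becomes injective with dense submaximal range. -/
theorem exists_injective_dense_relSubmaximal {Y Ξ : Type*} {φ : Y → Ξ → Bool}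
    (hφ : ∀ s x, (cylinder φ s x).Infinite) {f : Ξ → Set Y × Y} (hf : Function.Surjective f) :
    ∃ ψ : Y → Ξ → Bool, Function.Injective ψ ∧ Dense (range ψ) ∧ RelSubmaximal (range ψ) := by
  classical
  obtain ⟨F, hFc, hFcyl, hFmin⟩ := exists_filter_minimal hφ
  -- A coordinate coding `(D, p)` with `Dᶜ ∈ F` is changed only on `D ∪ {p}`, which is `F`-null; if
  -- `p ∉ D`, it separates `p` from `D`.
  let ψ : Y → Ξ → Bool := fun y ξ =>
    if (f ξ).1ᶜ ∈ F then if y = (f ξ).2 then true else if y ∈ (f ξ).1 then false else φ y ξ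
    else φ y ξ
  have hsep : ∀ D, Dᶜ ∈ F → ∀ p ∉ D, ∃ ξ, ψ p ξ = true ∧ ∀ y ∈ D, ψ y ξ = false := by
    intro D hD p hp
    obtain ⟨ξ, hξ⟩ := hf (D, p)
    refine ⟨ξ, by simp [ψ, hξ, hD], fun y hy => ?_⟩
    have hyp : y ≠ p := fun h => hp (h ▸ hy)
    simp [ψ, hξ, hD, hy, hyp]
  have hfin : ∀ p : Y, ({p} : Set Y)ᶜ ∈ F := fun p => hFc (finite_singleton p).compl_mem_cofinite
  have hinj : Function.Injective ψ := by
    intro p q hpq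
    by_contra hne
    obtain ⟨ξ, h1, h2⟩ := hsep {q} (hfin q) p hne
    have := h2 q rfl
    rw [← hpq, h1] at this
    cases this
  have hagree : ∀ s : Finset Ξ, {y | ∀ ξ ∈ s, ψ y ξ = φ y ξ} ∈ F := by
    intro s
    have : {y | ∀ ξ ∈ s, ψ y ξ = φ y ξ} = ⋂ ξ ∈ s, {y | ψ y ξ = φ y ξ} := by ext; simp
    rw [this, biInter_finset_mem]
    intro ξ _
    by_cases h : (f ξ).1ᶜ ∈ F
    · filter_upwards [h, hfin (f ξ).2] with y hy1 hy2
      have hy1' : y ∉ (f ξ).1 := hy1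
      have hy2' : y ≠ (f ξ).2 := hy2
      simp [ψ, h, hy1', hy2']
    · simp [ψ, h]
  have hmeet : ∀ s x, ∀ I ∈ F, (cylinder ψ s x ∩ I).Nonempty := by
    intro s x I hI
    by_contra hcon
    refine hFcyl s x (mem_of_superset (inter_mem hI (hagree s)) ?_)
    rintro y ⟨hyI, hyA⟩ hyc
    exact hcon ⟨y, fun ξ hξ => (hyA ξ hξ).trans (hyc ξ hξ), hyI⟩
  have hclosed : ∀ D, Dᶜ ∈ F → ∃ C : Set (Ξ → Bool), IsClosed C ∧ ψ ⁻¹' C = D := by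
    intro D hD
    refine ⟨closure (ψ '' D), isClosed_closure, Subset.antisymm (fun p hp => ?_)
      fun p hp => subset_closure ⟨p, hp, rfl⟩⟩
    by_contra hpD
    obtain ⟨ξ, h1, h2⟩ := hsep D hD p hpD
    obtain ⟨_, hz, y, hy, rfl⟩ := mem_closure_iff.1 hp {z : Ξ → Bool | z ξ = true}
      ((isOpen_discrete ({true} : Set Bool)).preimage (f := fun z : Ξ → Bool => z ξ)
        (continuous_apply ξ)) h1
    have hz' : ψ y ξ = true := hz
    rw [h2 y hy] at hz'
    cases hz'
  refine ⟨ψ, hinj, ?_, ?_⟩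
  · refine dense_iff_inter_open.2 fun O hO ⟨x, hx⟩ => ?_
    obtain ⟨s, hs⟩ := exists_finset_cylinder_subset hO hx
    obtain ⟨y, hy, -⟩ := hmeet s x univ univ_mem
    exact ⟨ψ y, hs hy, y, rfl⟩
  · refine relSubmaximal_of_isSubmaximal fun S hS => ?_
    let A : Set Y := {y | (⟨ψ y, y, rfl⟩ : range ψ) ∈ S}
    have hA : A ∈ F := by
      by_contra hA
      obtain ⟨s, x, I, hI, hIA⟩ := hFmin A hA
      -- Members of `F` are open in the range of `ψ`, so the cylinder meets this one in a nonempty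
      -- open set that misses `S`.
      have hJ := inter_mem hI (hagree s)
      obtain ⟨C, hC, hCe⟩ := hclosed (I ∩ {y | ∀ ξ ∈ s, ψ y ξ = φ y ξ})ᶜ (by rwa [compl_compl])
      have hCm : ∀ y, ψ y ∉ C ↔ y ∈ I ∩ {y | ∀ ξ ∈ s, ψ y ξ = φ y ξ} := fun y => by
        rw [← mem_preimage, hCe, mem_compl_iff, not_not]
      obtain ⟨y, hy, hyJ⟩ := hmeet s x _ hJ
      have hopen : IsOpen (Subtype.val ⁻¹' (cylinder id s x ∩ Cᶜ) : Set (range ψ)) :=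
        ((isOpen_cylinder s x).inter hC.isOpen_compl).preimage continuous_subtype_val
      obtain ⟨⟨_, z, rfl⟩, ⟨hz1, hz2⟩, hzS⟩ := hS.inter_open_nonempty _ hopen
        ⟨⟨ψ y, y, rfl⟩, hy, (hCm y).2 hyJ⟩
      have hzJ := (hCm z).1 hz2
      exact hIA ⟨fun ξ hξ => (hzJ.2 ξ hξ).symm.trans (hz1 ξ hξ), hzJ.1⟩ hzS
    obtain ⟨C, hC, hCe⟩ := hclosed Aᶜ (by rwa [compl_compl])
    refine isOpen_induced_iff.2 ⟨Cᶜ, hC.isOpen_compl, ?_⟩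
    ext ⟨_, y, rfl⟩
    have : ψ y ∈ C ↔ y ∉ A := by rw [← mem_preimage, hCe]; rfl
    simpa [A] using this.not

/-- The independent family of Fichtenholz, Kantorovich and Hausdorff, as a coding with infinite
cylinders. -/
theorem exists_infinite_cylinder {α Ξ : Type*} {e : Ξ → Set α} (he : Function.Injective e) :
    ∃ φ : Finset α × Finset (Finset α) × ℕ → Ξ → Bool, ∀ s x, (cylinder φ s x).Infinite := by
  classical
  refine ⟨fun y ξ => decide (y.1.filter (· ∈ e ξ) ∈ y.2.1), fun s x => ?_⟩
  have hdiff : ∀ ξ η : Ξ, ∃ a : Option α, ξ ≠ η → ∃ b ∈ a, ¬ (b ∈ e ξ ↔ b ∈ e η) := by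
    intro ξ η
    by_cases h : ξ = η
    · exact ⟨none, fun h' => absurd h h'⟩
    · have : ∃ b, ¬ (b ∈ e ξ ↔ b ∈ e η) := by
        by_contra! hcon
        exact h (he (Set.ext hcon))
      obtain ⟨b, hb⟩ := this
      exact ⟨some b, fun _ => ⟨b, rfl, hb⟩⟩
  choose d hd using hdiff
  let t : Finset α := (s ×ˢ s).biUnion fun p => (d p.1 p.2).toFinset
  have ht : ∀ ξ ∈ s, ∀ η ∈ s, t.filter (· ∈ e ξ) = t.filter (· ∈ e η) → ξ = η := by
    intro ξ hξ η hη h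
    by_contra hne
    obtain ⟨b, hb, hbe⟩ := hd ξ η hne
    have hbt : b ∈ t :=
      Finset.mem_biUnion.2 ⟨(ξ, η), Finset.mk_mem_product hξ hη, Option.mem_toFinset.2 hb⟩
    have := congrArg (b ∈ ·) h
    simp only [Finset.mem_filter, hbt, true_and, eq_iff_iff] at this
    exact hbe this
  let r : Finset (Finset α) := (s.filter fun ξ => x ξ = true).image fun ξ => t.filter (· ∈ e ξ)
  -- `t` separates the sets `e ξ` for `ξ ∈ s`, and `r` lists the traces to be coded `true`; the free
  -- number `k` gives infinitely many points.
  refine Set.infinite_of_injective_forall_mem (f := fun k : ℕ => (t, r, k))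
    (fun k l h => by simpa using h) fun k ξ hξ => ?_
  rw [Bool.eq_iff_iff, decide_eq_true_iff]
  simp only [r, Finset.mem_image, Finset.mem_filter]
  constructor
  · rintro ⟨η, ⟨hη, hηx⟩, h⟩
    rwa [← ht η hη ξ hξ h]
  · exact fun h => ⟨ξ, ⟨hξ, h⟩, rfl⟩

/-! ### Disjoint translates -/

/-- Translation of the Cantor cube by `g`. -/
def xorHomeomorph {Ξ : Type*} (g : Ξ → Bool) : (Ξ → Bool) ≃ₜ (Ξ → Bool) where
  toFun x ξ := x ξ ^^ g ξ
  invFun x ξ := x ξ ^^ g ξ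
  left_inv x := by ext ξ; simp
  right_inv x := by ext ξ; simp
  continuous_toFun := continuous_pi fun ξ =>
    (continuous_of_discreteTopology (f := fun b : Bool => b ^^ g ξ)).comp (continuous_apply ξ)
  continuous_invFun := continuous_pi fun ξ =>
    (continuous_of_discreteTopology (f := fun b : Bool => b ^^ g ξ)).comp (continuous_apply ξ)

/-- A coding with sufficiently many coordinates has a family of pairwise disjoint translates. -/
theorem exists_disjoint_translates {Y Ξ ι : Type*} (ψ : Y → Ξ → Bool)
    {f : Ξ → (Y × Y) × ι} (hf : Function.Surjective f) :
    ∃ g : ι → Ξ → Bool, ∀ i j, i ≠ j →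
      Disjoint (xorHomeomorph (g i) '' range ψ) (xorHomeomorph (g j) '' range ψ) := by
  classical
  -- At a coordinate coding `((y, z), i)`, translate `i` sends `ψ y` to the negation of `ψ z`, while
  -- the other translates fix `ψ z`.
  refine ⟨fun k ξ => if k = (f ξ).2 then !(ψ (f ξ).1.1 ξ ^^ ψ (f ξ).1.2 ξ) else false,
    fun i j hij => ?_⟩
  rw [disjoint_left]
  rintro _ ⟨_, ⟨y, rfl⟩, rfl⟩ ⟨_, ⟨z, rfl⟩, h⟩
  obtain ⟨ξ, hξ⟩ := hf ((y, z), i)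
  have : (ψ z ξ ^^ if j = (f ξ).2 then !(ψ (f ξ).1.1 ξ ^^ ψ (f ξ).1.2 ξ) else false) =
      (ψ y ξ ^^ if i = (f ξ).2 then !(ψ (f ξ).1.1 ξ ^^ ψ (f ξ).1.2 ξ) else false) := congrFun h ξ
  rw [hξ, if_neg hij.symm, if_pos rfl] at this
  revert this
  cases ψ y ξ <;> cases ψ z ξ <;> simp

/-- The Cantor cube `{0,1}^(2^κ)` contains any finite number of pairwise disjoint dense submaximal
subspaces of size `κ`. -/
theorem exists_disjoint_dense_relSubmaximal (m : ℕ) (κ : Cardinal.{u})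
    (hκ : Cardinal.aleph0 ≤ κ) :
    ∃ D : Fin m → Set (CantorCube κ), (∀ i j, i ≠ j → Disjoint (D i) (D j)) ∧
      ∀ i, Dense (D i) ∧ RelSubmaximal (D i) ∧ Cardinal.mk (D i) = κ := by
  let α : Type u := Quotient.out κ
  have hα : Cardinal.mk α = κ := Cardinal.mk_out κ
  have hΞ : Cardinal.mk (Quotient.out (2 ^ κ : Cardinal.{u})) = 2 ^ κ := Cardinal.mk_out _
  have : Infinite α := Cardinal.infinite_iff.2 (hα ▸ hκ)
  let Y : Type u := Finset α × Finset (Finset α) × ℕ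
  have hY : Cardinal.mk Y = κ := by
    simp only [Y, Cardinal.mk_prod, Cardinal.lift_id, Cardinal.mk_finset_of_infinite, hα,
      Cardinal.mk_nat, Cardinal.lift_aleph0, Cardinal.lift_uzero]
    rw [Cardinal.mul_aleph0_eq hκ, Cardinal.mul_eq_self hκ]
  have hκ2 : κ ≤ 2 ^ κ := (Cardinal.cantor κ).le
  have hinf : Cardinal.aleph0 ≤ 2 ^ κ := hκ.trans hκ2
  have : Infinite Y := Cardinal.infinite_iff.2 (hY ▸ hκ)
  obtain ⟨e⟩ : Nonempty (Quotient.out (2 ^ κ : Cardinal.{u}) ≃ Set α) := by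
    rw [← Cardinal.eq, hΞ, Cardinal.mk_set, hα]
  obtain ⟨f⟩ : Nonempty (Quotient.out (2 ^ κ : Cardinal.{u}) ≃ Set Y × Y) := by
    rw [← Cardinal.eq, hΞ, Cardinal.mk_prod, Cardinal.lift_id, Cardinal.lift_id,
      Cardinal.mk_set, hY, Cardinal.mul_eq_left hinf hκ2 (Cardinal.aleph0_pos.trans_le hκ).ne']
  obtain ⟨φ, hφ⟩ := exists_infinite_cylinder e.injective
  obtain ⟨ψ, hinj, hd, hs⟩ := exists_injective_dense_relSubmaximal hφ f.surjective
  rcases Nat.eq_zero_or_pos m with rfl | hm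
  · exact ⟨fun i => i.elim0, fun i => i.elim0, fun i => i.elim0⟩
  have : Nonempty (Fin m) := ⟨⟨0, hm⟩⟩
  obtain ⟨f', hf'⟩ : ∃ f' : Quotient.out (2 ^ κ : Cardinal.{u}) → (Y × Y) × Fin m,
      Function.Surjective f' := by
    have : Cardinal.mk ((Y × Y) × Fin m) ≤ Cardinal.mk (Quotient.out (2 ^ κ : Cardinal.{u})) := by
      rw [hΞ]
      simp only [Cardinal.mk_prod, Cardinal.lift_id, hY, Cardinal.mul_eq_self hκ,
        Cardinal.mk_fin, Cardinal.lift_natCast, Cardinal.lift_uzero]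
      exact (Cardinal.mul_le_max_of_aleph0_le_left hκ).trans
        (max_le hκ2 ((Cardinal.natCast_lt_aleph0).le.trans hinf))
    obtain ⟨i⟩ := this
    exact ⟨Function.invFun i, Function.invFun_surjective i.injective⟩
  obtain ⟨g, hg⟩ := exists_disjoint_translates ψ hf'
  refine ⟨fun i => xorHomeomorph (g i) '' range ψ, hg, fun i => ⟨?_, hs.image_homeomorph _, ?_⟩⟩
  · exact (xorHomeomorph (g i)).surjective.denseRange.dense_image
      (xorHomeomorph (g i)).continuous hd
  · rw [Cardinal.mk_image_eq (xorHomeomorph (g i)).injective, Cardinal.mk_range_eq _ hinj, hY]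

end Resolvability

theorem theorem3p7 (n : ℕ) (hn : 1 < n) (κ : Cardinal.{u}) (hκ : Cardinal.aleph0 ≤ κ) :
    ∃ X : Set (Resolvability.CantorCube κ),
      Cardinal.mk X = κ ∧
      T35Space X ∧
      Resolvability.IsResolvable n (instTopologicalSpaceSubtype : TopologicalSpace X) ∧
      (¬ ∃ U : TopologicalSpace X,
        Resolvability.IsExpansion U (instTopologicalSpaceSubtype : TopologicalSpace X) ∧
        Resolvability.IsExactlyResolvable n U ∧ Resolvability.IsQuasiRegular U) ∧
      ∃ D : Fin (n + 1) → Set (Resolvability.CantorCube κ),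
        X = ⋃ i, D i ∧
        (∀ i j, i ≠ j → Disjoint (D i) (D j)) ∧
        ∀ i, Dense (D i) ∧
          Resolvability.IsSubmaximal (instTopologicalSpaceSubtype : TopologicalSpace (D i)) := by
  obtain ⟨D, hdisj, hD⟩ := Resolvability.exists_disjoint_dense_relSubmaximal (n + 1) κ hκ
  have hsub : ∀ i, D i ⊆ ⋃ i, D i := Set.subset_iUnion D
  have hdisj' : ∀ i j, i ≠ j → Disjoint (Subtype.val ⁻¹' D i : Set (⋃ i, D i : Set _))
      (Subtype.val ⁻¹' D j) := fun i j hij => (hdisj i j hij).preimage _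
  have hdense : ∀ i, Dense (Subtype.val ⁻¹' D i : Set (⋃ i, D i : Set _)) := by
    intro i x
    rw [closure_subtype, Subtype.image_preimage_coe, Set.inter_eq_right.2 (hsub i)]
    exact (hD i).1 x
  have hne : ∀ i, (D i).Nonempty := fun i => (hD i).1.nonempty
  have hne' : ∀ i, (Subtype.val ⁻¹' D i : Set (⋃ i, D i : Set _)).Nonempty := by
    intro i
    obtain ⟨x, hx⟩ := hne i
    exact ⟨⟨x, hsub i hx⟩, hx⟩
  refine ⟨⋃ i, D i, le_antisymm ?_ ?_, inferInstance, ?_, ?_, D, rfl, hdisj,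
    fun i => ⟨(hD i).1, (hD i).2.1.isSubmaximal⟩⟩
  · have h := Cardinal.mk_iUnion_le_sum_mk_lift (f := D)
    simp only [fun i => (hD i).2.2, Cardinal.sum_const, Cardinal.lift_uzero, Cardinal.mk_fin,
      Cardinal.lift_natCast] at h
    exact h.trans ((Cardinal.mul_le_max_of_aleph0_le_right hκ).trans
      (max_le (Cardinal.natCast_lt_aleph0.le.trans hκ) le_rfl))
  · exact (hD 0).2.2.ge.trans (Cardinal.mk_le_mk_of_subset (hsub 0))
  · exact ⟨fun i => Subtype.val ⁻¹' D i.castSucc,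
      fun i j hij => hdisj' _ _ fun h => hij (Fin.castSucc_injective n h),
      fun i => ⟨hne' _, hdense _⟩⟩
  · rintro ⟨U, hU, ⟨hres, hnres⟩, hqr⟩
    refine hnres ⟨fun i => Subtype.val ⁻¹' D i, hdisj', fun i => ⟨hne' i, ?_⟩⟩
    refine Resolvability.dense_of_isQuasiRegular_expansion hn inferInstance
      (D := fun i => Subtype.val ⁻¹' D i) ?_ (fun i => (hD i).2.1.preimage_val _) hdense
      hU hres hqr i
    rw [← Set.preimage_iUnion]
    exact Subtype.coe_preimage_self _
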